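/- For $k\in\mathbb N$ and $m\ge 0$ put $f_k(m)=e^{-m}\sum_{j=0}^{k}\frac{m^j}{j!}$ and $\sigma^2_{m,k}=f_k(m)\{1-f_k(m)\}-\frac{e^{-2m}m^{2k+1}}{(k!)^2}$. Let $\mu>0$ and $\lambda>0$, let $X$ be Poisson with parameter $\mu$, and let $Y\ge 0$ be a real random variable with $E[Y]=\mu$ and $E[Y^2]<\infty$. For each $n\ge\lambda^2$ let $A_n$ be an event with $P(A_n)=1-\frac{\lambda}{\sqrt n}$ such that $X$, $Y$ and $I(A_n)$ are independent, and let $X^{(n)}_1,\dots,X^{(n)}_n$ be independent random variables, each distributed as $I(A_n)X+I(A_n^c)Y$. Let $\overline X'_n=\frac1n\sum_{i}X^{(n)}_i$, $F'_n(k)=\frac1n\sum_i I(X^{(n)}_i\le k)$ and $$U^{(k)}_n=\sqrt n\,\{f_k(\overline X'_n)-F'_n(k)\},\qquad k^*_n=\min\Big\{k\ge 0:\ I(\overline X'_n\ge 1)\,\frac{\widetilde\sigma_{n,k}}{f_k^2(\overline X'_n)\sqrt n}\le e\Big\},$$ where $\widetilde\sigma_{n,k}=\sqrt{\sigma^2_{\overline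 X'_n,k}}$. Then, as $n\to\infty$: 1. For every fixed $k\in\mathbb N$, $U^{(k)}_n$ converges in distribution to $\mathcal N(\tau_k,\sigma^2_{\mu,k})$, where $\tau_k=-\lambda\{P(Y\le k)-f_k(\mu)\}$; moreover $\sigma^2_{\mu,k}=\mathrm{Var}\big[e^{-\mu}\frac{\mu^k}{k!}X+I(X\le k)\big]$. 2. $U^{(k^*_n)}_n$ is asymptotically equivalent to $U^{(0)}_n$, that is, $U^{(k^*_n)}_n-U^{(0)}_n$ converges to $0$ in probability; and both $U^{(0)}_n$ and $U^{(k^*_n)}_n$ converge in distribution to $\mathcal N\big(\lambda\{e^{-\mu}-P(Y=0)\},\,e^{-2\mu}(e^{\mu}-1-\mu)\big)$. -/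

import Mathlib

open MeasureTheory ProbabilityTheory Filter Topology
open scoped NNReal ENNReal Nat

noncomputable section

namespace PoissonTest

/-- `f_k(m) = e^{-m} (1 + m + ... + m^k / k!)`. -/
def f (k : ℕ) (m : ℝ) : ℝ :=
  Real.exp (-m) * ∑ j ∈ Finset.range (k + 1), m ^ j / (j ! : ℝ)

/-- `σ²_{m,k} = f_k(m) (1 - f_k(m)) - e^{-2m} m^{2k+1} / (k!)²`. -/
def sigmaSq (k : ℕ) (m : ℝ) : ℝ :=
  f k m * (1 - f k m) - Real.exp (-2 * m) * m ^ (2 * k + 1) / (k ! : ℝ) ^ 2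

/-- The sample mean of `x_1, ..., x_n`. -/
def sampleMean {n : ℕ} (x : Fin n → ℝ) : ℝ :=
  (∑ i, x i) / n

/-- The empirical cumulative distribution function of `x_1, ..., x_n` at `t`. -/
def empCdf {n : ℕ} (x : Fin n → ℝ) (t : ℝ) : ℝ :=
  (∑ i, if x i ≤ t then (1 : ℝ) else 0) / n

/-- The statistic `√n (f_k(mean) - F_n(k))` of the sample `x_1, ..., x_n`. -/
def stat (k : ℕ) {n : ℕ} (x : Fin n → ℝ) : ℝ :=
  √(n : ℝ) * (f k (sampleMean x) - empCdf x k)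

/-- The plug-in estimator of `σ_{μ,k}`. -/
def sigmaHat (k : ℕ) {n : ℕ} (x : Fin n → ℝ) : ℝ :=
  √(sigmaSq k (sampleMean x))

/-- The data-driven index: the least `k ≥ 0` such that
`I(mean ≥ 1) * sigmaHat / (f_k(mean)² √n) ≤ e`. -/
def kStar {n : ℕ} (x : Fin n → ℝ) : ℕ :=
  sInf {k : ℕ | (if 1 ≤ sampleMean x then (1 : ℝ) else 0) *
    (sigmaHat k x / (f k (sampleMean x) ^ 2 * √(n : ℝ))) ≤ Real.exp 1}

end PoissonTest

end

/-! The derivative of `f k` at `mu` is minus the Poisson weight `c = e^{-mu} mu^k / k!`. By the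
delta method, `stat k` is therefore, up to an error tending to zero in probability, the normalized
sum `n^{-1/2} ∑ h(S_i)` with `h(z) = f_k(mu) - 1{z ≤ k} - c (z - mu)`. Here `h(X)` is centred, and
its variance is `sigmaSq k mu` by the Stein identity of the Poisson law.

The summands have a law that changes with `n`, so the limit is found from characteristic functions
(`tendsto_mixture_pow`, `tendsto_charFun_mixture_sum`). The contaminating component has weight `lam
/ √n`: its first-order term, summed over `n` observations at scale `n^{-1/2}`, leaves the drift `lam
* E[h(Y)]`, while its effect on the variance disappears. Since `E[Y] = mu`, the linear part of `h`
adds nothing to the drift. The equality of means also makes the sample mean `√n`-consistent for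
`mu`, which controls the delta-method remainder.

For the data-driven index, the sample mean is at most `mu + 1` with probability tending to one, and
there index 0 passes the test for all large `n`. The two statistics then coincide, and Slutsky's
lemma transfers the limit. -/

namespace PoissonTest

open Asymptotics

/-! ### Expansions of characteristic functions and powers of mixtures -/

/-- The characteristic function of a centred square integrable law, to second order at `0`. -/
lemma charFun_sub_isLittleO_sq {ρ : Measure ℝ} [IsProbabilityMeasure ρ] (hρ : MemLp id 2 ρ)
    (h0 : ∫ x, x ∂ρ = 0) :
    (fun s : ℝ => charFun ρ s - (1 - ((∫ x, x ^ 2 ∂ρ : ℝ) : ℂ) * s ^ 2 / 2))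
      =o[𝓝 0] fun s : ℝ => s ^ 2 := by
  have h := taylor_isLittleO_univ (x₀ := 0) (contDiff_charFun (n := 2) (μ := ρ) (by exact_mod_cast hρ))
  simp only [sub_zero] at h
  refine h.congr_left fun s => ?_
  have h2 := taylorWithinEval_charFun_two_zero (P := ρ) (X := id) aemeasurable_id
    (by simpa using hρ) s
  rw [Measure.map_id] at h2
  rw [h2]
  simp [h0]

/-- The characteristic function of an integrable law, to first order at `0`. -/
lemma charFun_sub_isLittleO {ρ : Measure ℝ} [IsProbabilityMeasure ρ] (hρ : Integrable id ρ) :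
    (fun s : ℝ => charFun ρ s - (1 + ((∫ x, x ∂ρ : ℝ) : ℂ) * s * Complex.I))
      =o[𝓝 0] fun s : ℝ => s := by
  have hρ' : MemLp id (1 : ℕ) ρ := by simpa using memLp_one_iff_integrable.2 hρ
  have h := taylor_isLittleO_univ (x₀ := 0) (contDiff_charFun (n := 1) (μ := ρ) hρ')
  simp only [sub_zero, pow_one] at h
  refine h.congr_left fun s => ?_
  rw [taylorWithinEval_charFun_zero hρ']
  simp [Finset.sum_range_succ]
  ring

/-- Powers of a mixture of characteristic functions whose contamination has weight
`lam / √n`. -/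
lemma tendsto_mixture_pow {χ ψ : ℝ → ℂ} {v m : ℝ}
    (hχ : (fun s : ℝ => χ s - (1 - (v : ℂ) * s ^ 2 / 2)) =o[𝓝 0] fun s : ℝ => s ^ 2)
    (hψ : (fun s : ℝ => ψ s - (1 + (m : ℂ) * s * Complex.I)) =o[𝓝 0] fun s : ℝ => s)
    (lam t : ℝ) :
    Tendsto (fun n : ℕ => (((1 - lam / √(n : ℝ) : ℝ) : ℂ) * χ ((√(n : ℝ))⁻¹ * t)
        + ((lam / √(n : ℝ) : ℝ) : ℂ) * ψ ((√(n : ℝ))⁻¹ * t)) ^ n) atTop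
      (𝓝 (Complex.exp (t * (lam * m : ℝ) * Complex.I - v * t ^ 2 / 2))) := by
  set x : ℕ → ℝ := fun n => (√(n : ℝ))⁻¹ with hx
  have hx0 : Tendsto x atTop (𝓝 0) :=
    tendsto_inv_atTop_zero.comp (Real.tendsto_sqrt_atTop.comp tendsto_natCast_atTop_atTop)
  have hxt : Tendsto (fun n => x n * t) atTop (𝓝 0) := by simpa using hx0.mul_const t
  set a : ℕ → ℂ := fun n => χ (x n * t) - (1 - (v : ℂ) * ((x n * t : ℝ) : ℂ) ^ 2 / 2) with ha
  set b : ℕ → ℂ := fun n => ψ (x n * t) - (1 + (m : ℂ) * ((x n * t : ℝ) : ℂ) * Complex.I) with hb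
  have ha0 : Tendsto (fun n => a n / ((x n : ℂ) ^ 2)) atTop (𝓝 0) := by
    have h1 : a =o[atTop] fun n => (x n * t) ^ 2 := hχ.comp_tendsto hxt
    have h2 : a =o[atTop] fun n => (x n : ℂ) ^ 2 := by
      refine h1.trans_isBigO (IsBigO.of_bound (t ^ 2) (.of_forall fun n => ?_))
      simp [mul_pow, mul_comm]
    exact h2.tendsto_div_nhds_zero
  have hb0 : Tendsto (fun n => b n / (x n : ℂ)) atTop (𝓝 0) := by
    have h1 : b =o[atTop] fun n => x n * t := hψ.comp_tendsto hxt
    have h2 : b =o[atTop] fun n => (x n : ℂ) := by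
      refine h1.trans_isBigO (IsBigO.of_bound |t| (.of_forall fun n => ?_))
      simp [mul_comm]
    exact h2.tendsto_div_nhds_zero
  have hxC : Tendsto (fun n => (x n : ℂ)) atTop (𝓝 0) := by
    simpa [Function.comp_def] using (Complex.continuous_ofReal.tendsto 0).comp hx0
  set g : ℕ → ℂ := fun n => ((1 - lam / √(n : ℝ) : ℝ) : ℂ) * χ (x n * t)
        + ((lam / √(n : ℝ) : ℝ) : ℂ) * ψ (x n * t) - 1 with hg
  have key : Tendsto (fun n : ℕ => (n : ℂ) * g n) atTop
      (𝓝 (t * (lam * m : ℝ) * Complex.I - v * t ^ 2 / 2)) := by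
    -- With `x = 1/√n` and `n = x⁻²`, this is `n * g n` rewritten. The contamination weight `lam *
    -- x` already supplies one factor `x`, so a first-order expansion of `ψ` suffices.
    have hlim : Tendsto (fun n => (1 - lam * (x n : ℂ)) * (a n / (x n : ℂ) ^ 2 - v * t ^ 2 / 2)
        + lam * (b n / (x n : ℂ) + m * t * Complex.I)) atTop
        (𝓝 ((1 - lam * (0 : ℂ)) * (0 - v * t ^ 2 / 2) + lam * (0 + m * t * Complex.I))) :=
      ((tendsto_const_nhds.sub (hxC.const_mul _)).mul (ha0.sub_const _)).add
        ((hb0.add_const _).const_mul _)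
    have heq : ((1 - lam * (0 : ℂ)) * (0 - v * t ^ 2 / 2) + lam * (0 + m * t * Complex.I))
        = t * (lam * m : ℝ) * Complex.I - v * t ^ 2 / 2 := by
      push_cast; ring
    rw [heq] at hlim
    refine hlim.congr' ?_
    filter_upwards [eventually_gt_atTop 0] with n hn
    have hn' : (0 : ℝ) < n := by exact_mod_cast hn
    have hxpos : x n ≠ 0 := inv_ne_zero (Real.sqrt_pos.2 hn').ne'
    have hxpos' : (x n : ℂ) ≠ 0 := by exact_mod_cast hxpos
    have hnx : (n : ℂ) = 1 / (x n : ℂ) ^ 2 := by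
      have : (n : ℝ) = 1 / x n ^ 2 := by
        rw [hx]; simp only [inv_pow, Real.sq_sqrt hn'.le]; simp
      exact_mod_cast congrArg (fun r : ℝ => (r : ℂ)) this
    have hlx : lam / √(n : ℝ) = lam * x n := div_eq_mul_inv _ _
    have hχn : χ (x n * t) = a n + (1 - (v : ℂ) * ((x n * t : ℝ) : ℂ) ^ 2 / 2) := by
      rw [ha]; ring
    have hψn : ψ (x n * t) = b n + (1 + (m : ℂ) * ((x n * t : ℝ) : ℂ) * Complex.I) := by
      rw [hb]; ring
    simp only [hg]
    rw [hnx, hlx, hχn, hψn]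
    push_cast
    field_simp
    ring
  refine (Complex.tendsto_one_add_pow_exp_of_tendsto key).congr fun n => ?_
  simp [hg, hx]

/-! ### Slutsky's lemma and the delta method on varying probability spaces -/

/-- The characteristic functions of two random variables that are close in probability. -/
lemma norm_charFun_map_sub_le {α : Type*} [MeasurableSpace α] {M : Measure α}
    [IsProbabilityMeasure M] {U V : α → ℝ} (hU : AEMeasurable U M) (hV : AEMeasurable V M)
    (t ε : ℝ) (hε : 0 ≤ ε) :
    ‖charFun (M.map V) t - charFun (M.map U) t‖ ≤ |t| * ε + 2 * M.real {ω | ε ≤ |V ω - U ω|} := by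
  rw [charFun_apply_real, charFun_apply_real, integral_map hV (by fun_prop),
    integral_map hU (by fun_prop)]
  have hint : ∀ {W : α → ℝ}, AEMeasurable W M →
      Integrable (fun ω => Complex.exp (t * W ω * Complex.I)) M := fun {W} hW => by
    refine Integrable.of_bound (by fun_prop) 1 (.of_forall fun ω => ?_)
    rw [← Complex.ofReal_mul, Complex.norm_exp_ofReal_mul_I]
  rw [← integral_sub (hint hV) (hint hU)]
  have hset : NullMeasurableSet {ω | ε ≤ |V ω - U ω|} M :=
    nullMeasurableSet_le aemeasurable_const (by fun_prop)
  have hind : Integrable ({ω | ε ≤ |V ω - U ω|}.indicator fun _ => (2 : ℝ)) M :=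
    (integrable_const _).indicator₀ hset
  calc _ ≤ ∫ ω, |t| * ε + {ω | ε ≤ |V ω - U ω|}.indicator (fun _ => (2 : ℝ)) ω ∂M := by
        refine norm_integral_le_of_norm_le ((integrable_const _).add hind) (.of_forall fun ω => ?_)
        by_cases hω : ε ≤ |V ω - U ω|
        · have : ∀ z : ℝ, ‖Complex.exp (t * z * Complex.I)‖ = 1 := fun z => by
            rw [← Complex.ofReal_mul, Complex.norm_exp_ofReal_mul_I]
          have h2 := norm_sub_le (Complex.exp (t * V ω * Complex.I))
            (Complex.exp (t * U ω * Complex.I))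
          rw [this, this] at h2
          rw [Set.indicator_of_mem (show ω ∈ {ω | ε ≤ |V ω - U ω|} from hω)]
          have : 0 ≤ |t| * ε := by positivity
          linarith
        · rw [Set.indicator_of_notMem (show ω ∉ {ω | ε ≤ |V ω - U ω|} from hω), add_zero]
          -- Factoring out a number of modulus one leaves `|e^{is} - 1| ≤ |s|` with `s = t (V - U)`.
          have h3 : Complex.exp (t * V ω * Complex.I) - Complex.exp (t * U ω * Complex.I)
              = Complex.exp ((t * U ω : ℝ) * Complex.I)
                * (Complex.exp (Complex.I * (t * (V ω - U ω) : ℝ)) - 1) := by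
            rw [mul_sub, ← Complex.exp_add, mul_one]
            push_cast
            ring_nf
          rw [h3, norm_mul, Complex.norm_exp_ofReal_mul_I, one_mul]
          refine (Real.norm_exp_I_mul_ofReal_sub_one_le).trans ?_
          rw [Real.norm_eq_abs, abs_mul]
          exact mul_le_mul_of_nonneg_left (not_le.1 hω).le (abs_nonneg t)
    _ = _ := by
        rw [integral_add (integrable_const _) hind, integral_indicator₀ hset]
        simp [mul_comm]

section VaryingSpaces

variable {Ω' : ℕ → Type*} [∀ n, MeasurableSpace (Ω' n)]
    {Q : (n : ℕ) → Measure (Ω' n)} [∀ n, IsProbabilityMeasure (Q n)]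

/-- Slutsky's lemma for a sequence of probability spaces: if `U n` converges in law to `ν` and
`V n - U n` converges to `0` in probability, then `V n` converges in law to `ν`. -/
theorem tendstoInDistribution_of_charFun {U V : (n : ℕ) → Ω' n → ℝ} {ν : Measure ℝ}
    [IsProbabilityMeasure ν] (hU : ∀ n, AEMeasurable (U n) (Q n))
    (hV : ∀ n, AEMeasurable (V n) (Q n))
    (hc : ∀ t, Tendsto (fun n => charFun ((Q n).map (U n)) t) atTop (𝓝 (charFun ν t)))
    (hUV : ∀ ε : ℝ, 0 < ε →
      Tendsto (fun n => (Q n).real {ω | ε ≤ |V n ω - U n ω|}) atTop (𝓝 0)) :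
    TendstoInDistribution V atTop id Q ν where
  forall_aemeasurable := hV
  aemeasurable_limit := aemeasurable_id
  tendsto := by
    refine ProbabilityMeasure.tendsto_iff_tendsto_charFun.2 fun t => ?_
    simp only [ProbabilityMeasure.coe_mk, Measure.map_id]
    have hdiff : Tendsto (fun n => charFun ((Q n).map (V n)) t - charFun ((Q n).map (U n)) t)
        atTop (𝓝 0) := by
      rw [Metric.tendsto_atTop']
      intro η hη
      -- This makes `|t| * ε < η / 2`, also when `t = 0`; the probability below `η / 4` enters with
      -- factor 2.
      set ε := η / (2 * (|t| + 1)) with hε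
      have hεpos : 0 < ε := by positivity
      have hlt : |t| * ε < η / 2 + 0 := by
        rw [hε, add_zero, ← mul_div_assoc, div_lt_div_iff₀ (by positivity) (by positivity)]
        nlinarith [abs_nonneg t]
      have h1 := (hUV ε hεpos).eventually_lt_const (show (0 : ℝ) < η / 4 by positivity)
      obtain ⟨N, hN⟩ := eventually_atTop.1 h1
      refine ⟨N, fun n hn => ?_⟩
      rw [dist_zero_right]
      have := norm_charFun_map_sub_le (hU n) (hV n) t ε hεpos.le
      have := hN n hn.le
      linarith
    simpa using hdiff.add (hc t)

/-- Differentiable functions of a `√n`-consistent estimator are asymptotically linear. -/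
lemma tendsto_measureReal_remainder {T : (n : ℕ) → Ω' n → ℝ} {θ C : ℝ}
    (hT : ∀ᶠ n : ℕ in atTop, ∀ c : ℝ, 0 < c →
      (Q n).real {ω | c ≤ |T n ω - θ|} ≤ C / (n * c ^ 2))
    {g : ℝ → ℝ} {g' : ℝ} (hg : HasDerivAt g g' θ) {ε : ℝ} (hε : 0 < ε) :
    Tendsto (fun n : ℕ => (Q n).real
      {ω | ε ≤ |√(n : ℝ) * (g (T n ω) - g θ - g' * (T n ω - θ))|}) atTop (𝓝 0) := by
  have hC : 0 ≤ C := by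
    obtain ⟨n, hn, hn0⟩ := (hT.and (eventually_gt_atTop 0)).exists
    have h := (measureReal_nonneg (μ := Q n)).trans (hn 1 one_pos)
    have hn' : (0 : ℝ) < n := by exact_mod_cast hn0
    by_contra hC
    have := div_neg_of_neg_of_pos (not_le.1 hC) (show (0 : ℝ) < n * 1 ^ 2 by simpa using hn')
    linarith
  rw [Metric.tendsto_atTop']
  intro η hη
  -- `C c² / ε²` is the Chebyshev bound at the level `ε / (c √n)`; the factors `n` cancel.
  obtain ⟨c, hc, hcη⟩ : ∃ c : ℝ, 0 < c ∧ C * c ^ 2 / ε ^ 2 < η / 2 := by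
    have : Tendsto (fun c : ℝ => C * c ^ 2 / ε ^ 2) (𝓝[>] 0) (𝓝 0) := by
      have : Continuous fun c : ℝ => C * c ^ 2 / ε ^ 2 := by fun_prop
      simpa using (this.tendsto 0).mono_left nhdsWithin_le_nhds
    obtain ⟨c, h1, h2⟩ := ((this.eventually_lt_const (show (0 : ℝ) < η / 2 by positivity)).and
      self_mem_nhdsWithin).exists
    exact ⟨c, h2, h1⟩
  have hlo := hg.isLittleO.def hc
  obtain ⟨δ, hδ, hδc⟩ := Metric.eventually_nhds_iff.1 hlo
  have hlim : Tendsto (fun n : ℕ => C / (n * δ ^ 2)) atTop (𝓝 0) :=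
    tendsto_const_nhds.div_atTop
      (tendsto_natCast_atTop_atTop.atTop_mul_const (by positivity))
  obtain ⟨N, hN⟩ := eventually_atTop.1 ((hT.and (eventually_gt_atTop 0)).and
    (hlim.eventually_lt_const (show (0 : ℝ) < η / 2 by positivity)))
  refine ⟨N, fun n hn => ?_⟩
  obtain ⟨⟨hTn, hn0⟩, hNn⟩ := hN n hn.le
  have hn' : (0 : ℝ) < n := by exact_mod_cast hn0
  have hs : 0 < √(n : ℝ) := Real.sqrt_pos.2 hn'
  rw [dist_zero_right, Real.norm_of_nonneg measureReal_nonneg]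
  -- Within `δ` of `θ` the remainder is at most `c |T - θ|`, so a scaled remainder of at least `ε`
  -- forces `|T - θ| ≥ ε / (c √n)`.
  have hsub : {ω | ε ≤ |√(n : ℝ) * (g (T n ω) - g θ - g' * (T n ω - θ))|}
      ⊆ {ω | δ ≤ |T n ω - θ|} ∪ {ω | ε / (c * √(n : ℝ)) ≤ |T n ω - θ|} := by
    intro ω hω
    by_contra hcon
    simp only [Set.mem_union, Set.mem_ofPred_eq, not_or, not_le] at hcon hω
    have h1 := hδc (y := T n ω) (by rw [Real.dist_eq]; exact hcon.1)
    rw [Real.norm_eq_abs, Real.norm_eq_abs, smul_eq_mul, mul_comm (T n ω - θ)] at h1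
    rw [abs_mul, abs_of_pos hs] at hω
    have h2 := (lt_div_iff₀ (by positivity)).1 hcon.2
    have h3 := mul_le_mul_of_nonneg_left h1 hs.le
    nlinarith
  have hA := hTn δ hδ
  have hB := hTn (ε / (c * √(n : ℝ))) (by positivity)
  have hBe : C / (n * (ε / (c * √(n : ℝ))) ^ 2) = C * c ^ 2 / ε ^ 2 := by
    rw [div_pow, mul_pow, Real.sq_sqrt hn'.le]
    field_simp
  rw [hBe] at hB
  have := (measureReal_mono hsub (measure_ne_top (Q n) _)).trans (measureReal_union_le _ _)
  linarith

end VaryingSpaces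

/-! ### Sample means and laws of mixtures -/

/-- Chebyshev's inequality for the sample mean. -/
lemma measureReal_sampleMean_le {α : Type*} [MeasurableSpace α] {M : Measure α}
    [IsProbabilityMeasure M] {n : ℕ} (hn : 0 < n) {S : Fin n → α → ℝ} (hS : ∀ i, MemLp (S i) 2 M)
    (hind : iIndepFun S M) {θ C : ℝ} (hθ : ∀ i, ∫ ω, S i ω ∂M = θ) (hC : ∀ i, Var[S i; M] ≤ C)
    {c : ℝ} (hc : 0 < c) :
    M.real {ω | c ≤ |sampleMean (fun i => S i ω) - θ|} ≤ C / (n * c ^ 2) := by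
  have hn' : (0 : ℝ) < n := by exact_mod_cast hn
  have hsum : MemLp (∑ i, S i) 2 M := memLp_finsetSum' _ fun i _ => hS i
  have hmean : ∫ ω, (∑ i, S i) ω ∂M = n * θ := by
    simp only [Finset.sum_apply]
    rw [integral_finsetSum _ fun i _ => (hS i).integrable (by norm_num)]
    simp [hθ]
  have hvar : Var[∑ i, S i; M] ≤ n * C := by
    rw [IndepFun.variance_sum (fun i _ => hS i) fun i _ j _ hij => hind.indepFun hij]
    refine (Finset.sum_le_sum fun i _ => hC i).trans ?_
    simp
  have hcheb := meas_ge_le_variance_div_sq hsum (c := n * c) (by positivity)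
  rw [hmean] at hcheb
  have hset : {ω | c ≤ |sampleMean (fun i => S i ω) - θ|}
      = {ω | n * c ≤ |(∑ i, S i) ω - n * θ|} := by
    ext ω
    simp only [Set.mem_ofPred_eq, sampleMean, Finset.sum_apply]
    have : (∑ i, S i ω) - n * θ = n * ((∑ i, S i ω) / n - θ) := by field_simp
    rw [this, abs_mul, abs_of_pos hn', mul_le_mul_iff_right₀ hn']
  rw [hset]
  calc _ ≤ Var[∑ i, S i; M] / (n * c) ^ 2 := by
        refine ENNReal.toReal_le_of_le_ofReal ?_ hcheb
        exact div_nonneg (variance_nonneg _ _) (by positivity)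
    _ ≤ n * C / (n * c) ^ 2 := by gcongr
    _ = _ := by field_simp

/-- The law of a mixture that selects `X` on the event `A` and `Y` off it. -/
lemma map_mixture {Ω : Type*} [MeasurableSpace Ω] {P : Measure Ω} [IsProbabilityMeasure P]
    {X Y : Ω → ℝ} {A : Set Ω} (hA : MeasurableSet A) (hX : AEMeasurable X P)
    (hY : AEMeasurable Y P) (hXA : IndepFun X (A.indicator fun _ => (1 : ℝ)) P)
    (hYA : IndepFun Y (A.indicator fun _ => (1 : ℝ)) P) :
    P.map (fun ω => A.indicator X ω + Aᶜ.indicator Y ω)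
      = P A • P.map X + P Aᶜ • P.map Y := by
  have hZ : AEMeasurable (fun ω => A.indicator X ω + Aᶜ.indicator Y ω) P :=
    (hX.indicator hA).add (hY.indicator hA.compl)
  have h1 : (A.indicator fun _ => (1 : ℝ)) ⁻¹' {1} = A := by
    ext ω; by_cases h : ω ∈ A <;> simp [h]
  have h0 : (A.indicator fun _ => (1 : ℝ)) ⁻¹' {0} = Aᶜ := by
    ext ω; by_cases h : ω ∈ A <;> simp [h]
  ext B hB
  have hXB := hXA.measure_inter_preimage_eq_mul B {1} hB (measurableSet_singleton _)
  have hYB := hYA.measure_inter_preimage_eq_mul B {0} hB (measurableSet_singleton _)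
  rw [h1] at hXB
  rw [h0] at hYB
  rw [Measure.map_apply_of_aemeasurable hZ hB]
  simp only [Measure.coe_add, Measure.coe_smul, Pi.add_apply, Pi.smul_apply, smul_eq_mul]
  rw [Measure.map_apply_of_aemeasurable hX hB, Measure.map_apply_of_aemeasurable hY hB,
    mul_comm, mul_comm (P Aᶜ), ← hXB, ← hYB, ← measure_inter_add_sdiff _ hA]
  congr 2
  · ext ω; by_cases h : ω ∈ A <;> simp [h]
  · ext ω; by_cases h : ω ∈ A <;> simp [h]

/-- Expectations under a mixture that selects `X` on the event `A` and `Y` off it. -/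
lemma integral_comp_mixture {Ω E : Type*} [MeasurableSpace Ω] {P : Measure Ω}
    [IsProbabilityMeasure P] [NormedAddCommGroup E] [NormedSpace ℝ E]
    {X Y : Ω → ℝ} {A : Set Ω} (hA : MeasurableSet A) (hX : AEMeasurable X P)
    (hY : AEMeasurable Y P) (hXA : IndepFun X (A.indicator fun _ => (1 : ℝ)) P)
    (hYA : IndepFun Y (A.indicator fun _ => (1 : ℝ)) P) {g : ℝ → E} (hg : StronglyMeasurable g)
    (hgX : Integrable (fun ω => g (X ω)) P) (hgY : Integrable (fun ω => g (Y ω)) P) :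
    ∫ ω, g (A.indicator X ω + Aᶜ.indicator Y ω) ∂P
      = P.real A • ∫ ω, g (X ω) ∂P + (1 - P.real A) • ∫ ω, g (Y ω) ∂P := by
  have hZ : AEMeasurable (fun ω => A.indicator X ω + Aᶜ.indicator Y ω) P :=
    (hX.indicator hA).add (hY.indicator hA.compl)
  have iX : Integrable g (P.map X) := (integrable_map_measure hg.aestronglyMeasurable hX).2 hgX
  have iY : Integrable g (P.map Y) := (integrable_map_measure hg.aestronglyMeasurable hY).2 hgY
  rw [← integral_map hZ hg.aestronglyMeasurable, map_mixture hA hX hY hXA hYA,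
    integral_add_measure (iX.smul_measure (measure_ne_top _ _))
      (iY.smul_measure (measure_ne_top _ _)), integral_smul_measure, integral_smul_measure,
    integral_map hX hg.aestronglyMeasurable, integral_map hY hg.aestronglyMeasurable,
    ← probReal_compl_eq_one_sub hA]
  rfl

/-! ### The Poisson distribution function and Poisson moments -/

lemma f_zero (m : ℝ) : f 0 m = Real.exp (-m) := by simp [f]

lemma f_succ (k : ℕ) (m : ℝ) :
    f (k + 1) m = f k m + Real.exp (-m) * m ^ (k + 1) / ((k + 1)! : ℝ) := by
  rw [f, f, Finset.sum_range_succ _ (k + 1)]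
  ring

/-- Each term differentiates into a difference of consecutive Poisson weights; the sum telescopes
and only the last weight survives. -/
lemma hasDerivAt_f (k : ℕ) (m : ℝ) :
    HasDerivAt (f k) (-(Real.exp (-m) * m ^ k / (k ! : ℝ))) m := by
  have hexp : HasDerivAt (fun x : ℝ => Real.exp (-x)) (-Real.exp (-m)) m := by
    simpa using (hasDerivAt_neg m).exp
  induction k with
  | zero => simpa [funext f_zero] using hexp
  | succ k ih =>
    have h := ih.add ((hexp.mul (hasDerivAt_pow (k + 1) m)).div_const ((k + 1)! : ℝ))
    have hfun : f (k + 1) = f k + fun x => (Real.exp (-x) * x ^ (k + 1)) / ((k + 1)! : ℝ) :=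
      funext fun x => f_succ k x
    rw [hfun]
    convert! h using 1
    rw [Nat.factorial_succ]
    push_cast
    field_simp
    simp

lemma continuous_f (k : ℕ) : Continuous (f k) :=
  continuous_iff_continuousAt.2 fun m => (hasDerivAt_f k m).continuousAt

lemma sigmaSq_zero (m : ℝ) :
    sigmaSq 0 m = Real.exp (-2 * m) * (Real.exp m - 1 - m) := by
  have h1 : Real.exp (-2 * m) = Real.exp (-m) * Real.exp (-m) := by
    rw [← Real.exp_add]; ring_nf
  have h2 : Real.exp (-m) * Real.exp m = 1 := by rw [← Real.exp_add]; simp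
  simp only [sigmaSq, f_zero, h1]
  simp
  linear_combination -Real.exp (-m) * h2

/-- The Stein identity of the Poisson distribution. -/
lemma integral_natCast_mul_poissonMeasure {r : ℝ≥0} {g : ℕ → ℝ}
    (hg : Integrable (fun n => g (n + 1)) (poissonMeasure r)) :
    Integrable (fun n : ℕ => (n : ℝ) * g n) (poissonMeasure r) ∧
      ∫ n : ℕ, (n : ℝ) * g n ∂poissonMeasure r = r * ∫ n, g (n + 1) ∂poissonMeasure r := by
  -- The recurrence `(n + 1) w(n + 1) = r w(n)` of the Poisson weights; the identity is this shift
  -- of index, the term at 0 being zero.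
  have hw : ∀ n : ℕ, Real.exp (-r) * (r : ℝ) ^ (n + 1) / ((n + 1)! : ℝ) * ((n + 1 : ℕ) : ℝ)
      = r * (Real.exp (-r) * (r : ℝ) ^ n / (n ! : ℝ)) := fun n => by
    rw [Nat.factorial_succ]
    push_cast
    field_simp
    ring
  constructor
  · rw [integrable_poissonMeasure_iff] at hg ⊢
    rw [← summable_nat_add_iff 1]
    refine (hg.mul_left (r : ℝ)).congr fun n => ?_
    rw [norm_mul, ← mul_assoc, ← mul_assoc, ← hw n, Real.norm_natCast]
  · rw [integral_poissonMeasure, integral_poissonMeasure, ← tsum_mul_left]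
    simp only [smul_eq_mul]
    have hzero : Function.support (fun n : ℕ => Real.exp (-r) * (r : ℝ) ^ n / (n ! : ℝ)
        * ((n : ℝ) * g n)) ⊆ Set.range Nat.succ := by
      intro n hn
      cases n with
      | zero => simp at hn
      | succ n => exact ⟨n, rfl⟩
    rw [← Nat.succ_injective.tsum_eq hzero]
    refine tsum_congr fun n => ?_
    rw [Nat.succ_eq_add_one, ← mul_assoc, ← mul_assoc, ← hw n]

lemma integral_natCast_poissonMeasure (r : ℝ≥0) :
    Integrable (fun n : ℕ => (n : ℝ)) (poissonMeasure r) ∧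
      ∫ n : ℕ, (n : ℝ) ∂poissonMeasure r = r := by
  simpa using integral_natCast_mul_poissonMeasure (r := r) (g := fun _ => 1)
    (integrable_const _)

lemma integral_natCast_sq_poissonMeasure (r : ℝ≥0) :
    Integrable (fun n : ℕ => (n : ℝ) * n) (poissonMeasure r) ∧
      ∫ n : ℕ, (n : ℝ) * n ∂poissonMeasure r = r * (r + 1) := by
  obtain ⟨hi, he⟩ := integral_natCast_poissonMeasure r
  have h := integral_natCast_mul_poissonMeasure (r := r) (g := fun n => (n : ℝ))
    (by simpa using hi.add (integrable_const 1))
  refine ⟨h.1, h.2.trans ?_⟩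
  simp only [Nat.cast_add, Nat.cast_one]
  rw [integral_add hi (integrable_const _), he]
  simp

lemma integral_ite_le_poissonMeasure (r : ℝ≥0) (k : ℕ) :
    ∫ n : ℕ, (if n ≤ k then (1 : ℝ) else 0) ∂poissonMeasure r = f k r := by
  rw [integral_poissonMeasure, tsum_eq_sum (s := Finset.range (k + 1)), f, Finset.mul_sum]
  · refine Finset.sum_congr rfl fun n hn => ?_
    rw [if_pos (Nat.lt_succ_iff.1 (Finset.mem_range.1 hn))]
    simp [mul_div_assoc]
  · intro n hn
    rw [if_neg fun h => hn (Finset.mem_range.2 (Nat.lt_succ_iff.2 h))]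
    simp

lemma integral_ite_succ_le_poissonMeasure (r : ℝ≥0) (k : ℕ) :
    ∫ n : ℕ, (if n + 1 ≤ k then (1 : ℝ) else 0) ∂poissonMeasure r
      = f k r - Real.exp (-r) * (r : ℝ) ^ k / (k ! : ℝ) := by
  cases k with
  | zero => simp [f_zero]
  | succ k =>
    simp only [add_le_add_iff_right]
    rw [integral_ite_le_poissonMeasure, f_succ]
    simp

lemma integrable_ite_poissonMeasure (r : ℝ≥0) (p : ℕ → Prop) [DecidablePred p] :
    Integrable (fun n : ℕ => if p n then (1 : ℝ) else 0) (poissonMeasure r) := by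
  refine Integrable.of_bound .of_discrete 1 (.of_forall fun n => ?_)
  split_ifs <;> simp

lemma memLp_natCast_poissonMeasure (r : ℝ≥0) :
    MemLp (fun n : ℕ => (n : ℝ)) 2 (poissonMeasure r) := by
  refine (memLp_two_iff_integrable_sq .of_discrete).2 ?_
  simpa [sq] using (integral_natCast_sq_poissonMeasure r).1

lemma memLp_ite_poissonMeasure (r : ℝ≥0) (k : ℕ) :
    MemLp (fun n : ℕ => if n ≤ k then (1 : ℝ) else 0) 2 (poissonMeasure r) := by
  refine MemLp.of_bound .of_discrete 1 (.of_forall fun n => ?_)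
  split_ifs <;> simp

/-- The Stein identity gives `E[N 1{N ≤ k}] = r (f_k - c)`, so the covariance of `N` with the
indicator is `-r c`. The variance is then `c² r - 2 c² r + f_k (1 - f_k)`. -/
lemma variance_poissonMeasure (r : ℝ≥0) (k : ℕ) :
    Var[fun n : ℕ => Real.exp (-(r : ℝ)) * (r : ℝ) ^ k / (k ! : ℝ) * n
      + (if n ≤ k then (1 : ℝ) else 0); poissonMeasure r] = sigmaSq k r := by
  set c := Real.exp (-(r : ℝ)) * (r : ℝ) ^ k / (k ! : ℝ) with hc
  obtain ⟨i1, e1⟩ := integral_natCast_poissonMeasure r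
  obtain ⟨i2, e2⟩ := integral_natCast_sq_poissonMeasure r
  have i3 := integrable_ite_poissonMeasure r (· ≤ k)
  have e3 := integral_ite_le_poissonMeasure r k
  obtain ⟨i4, e4⟩ := integral_natCast_mul_poissonMeasure (r := r)
    (g := fun n => if n ≤ k then (1 : ℝ) else 0) (integrable_ite_poissonMeasure r (· + 1 ≤ k))
  rw [integral_ite_succ_le_poissonMeasure, ← hc] at e4
  have hm : MemLp (fun n : ℕ => c * n + (if n ≤ k then (1 : ℝ) else 0)) 2 (poissonMeasure r) :=
    ((memLp_natCast_poissonMeasure r).const_mul c).add (memLp_ite_poissonMeasure r k)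
  rw [variance_eq_sub hm, integral_add (i1.const_mul c) i3, integral_const_mul, e1, e3]
  have hsq : ((fun n : ℕ => c * n + (if n ≤ k then (1 : ℝ) else 0)) ^ 2) = fun n : ℕ =>
      c ^ 2 * ((n : ℝ) * n) + 2 * c * ((n : ℝ) * (if n ≤ k then (1 : ℝ) else 0))
        + (if n ≤ k then (1 : ℝ) else 0) := by
    funext n
    simp only [Pi.pow_apply]
    split_ifs <;> ring
  have hint : ∫ n : ℕ, (c ^ 2 * ((n : ℝ) * n) + 2 * c * ((n : ℝ) * (if n ≤ k then (1 : ℝ) else 0))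
        + (if n ≤ k then (1 : ℝ) else 0)) ∂poissonMeasure r
      = c ^ 2 * (r * (r + 1)) + 2 * c * (r * (f k r - c)) + f k r := by
    rw [integral_add (by exact (i2.const_mul _).add (i4.const_mul _)) i3,
      integral_add (i2.const_mul _) (i4.const_mul _), integral_const_mul, integral_const_mul,
      e2, e3, e4]
  rw [hsq, hint, sigmaSq]
  have hc2 : Real.exp (-2 * r) * (r : ℝ) ^ (2 * k + 1) / (k ! : ℝ) ^ 2 = c ^ 2 * r := by
    have h1 : Real.exp (-2 * (r : ℝ)) = Real.exp (-(r : ℝ)) ^ 2 := by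
      rw [← Real.exp_nat_mul]; push_cast; ring_nf
    rw [hc, h1]
    field_simp
    ring
  rw [hc2]
  ring

/-! ### The data-driven index and its measurability -/

lemma kStar_eq_zero {n : ℕ} {x : Fin n → ℝ} {b : ℝ} (hx : sampleMean x ≤ b)
    (hn : Real.exp (2 * b) / √(n : ℝ) ≤ Real.exp 1) : kStar x = 0 := by
  -- Index 0 passes the test: below mean 1 the indicator vanishes, and otherwise `sigmaHat 0 x ≤ 1`
  -- while `(f 0 m)⁻² = e^{2m} ≤ e^{2b}`.
  refine Nat.sInf_eq_zero.2 (Or.inl ?_)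
  simp only [Set.mem_ofPred_eq]
  split_ifs with h1
  · rw [one_mul]
    refine le_trans ?_ hn
    set m := sampleMean x with hm
    have hsig : sigmaHat 0 x ≤ 1 := by
      rw [sigmaHat, Real.sqrt_le_iff, ← hm, sigmaSq, f_zero]
      refine ⟨zero_le_one, ?_⟩
      have h2 : Real.exp (-m) ≤ 1 := Real.exp_le_one_iff.2 (by linarith)
      have h3 : 0 ≤ Real.exp (-2 * m) * m ^ (2 * 0 + 1) / (0 ! : ℝ) ^ 2 := by positivity
      nlinarith [Real.exp_pos (-m)]
    have h4 : (f 0 m ^ 2)⁻¹ = Real.exp (2 * m) := by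
      rw [f_zero, ← Real.exp_nat_mul, ← Real.exp_neg]; push_cast; ring_nf
    rw [← div_div, div_eq_mul_inv (sigmaHat 0 x), h4]
    gcongr
    calc _ ≤ 1 * Real.exp (2 * m) := by gcongr
      _ ≤ _ := by rw [one_mul]; gcongr
  · simp [Real.exp_nonneg]

lemma measurable_sampleMean (n : ℕ) : Measurable (sampleMean (n := n)) := by
  unfold sampleMean; fun_prop

lemma measurable_stat (k n : ℕ) : Measurable (stat k (n := n)) := by
  refine measurable_const.mul (((continuous_f k).measurable.comp (measurable_sampleMean n)).sub ?_)
  refine (Finset.measurable_sum _ fun i _ => ?_).div_const _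
  exact Measurable.ite (measurableSet_le (measurable_pi_apply i) measurable_const)
    measurable_const measurable_const

lemma measurable_kStar (n : ℕ) : Measurable (kStar (n := n)) := by
  set p : ℕ → (Fin n → ℝ) → Prop := fun k x => (if 1 ≤ sampleMean x then (1 : ℝ) else 0) *
    (sigmaHat k x / (f k (sampleMean x) ^ 2 * √(n : ℝ))) ≤ Real.exp 1 with hp
  have hpm : ∀ k, MeasurableSet {x | p k x} := fun k => by
    have hf : Measurable fun x : Fin n → ℝ => f k (sampleMean x) :=
      (continuous_f k).measurable.comp (measurable_sampleMean n)
    have hs : Measurable fun x : Fin n → ℝ => sigmaHat k x := by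
      have := measurable_sampleMean n
      unfold sigmaHat sigmaSq
      fun_prop
    refine measurableSet_le (Measurable.mul ?_ (hs.div ((hf.pow_const 2).mul_const _)))
      measurable_const
    exact Measurable.ite (measurableSet_le measurable_const (measurable_sampleMean n))
      measurable_const measurable_const
  have hk : ∀ x, kStar x = sInf {k | p k x} := fun x => rfl
  refine measurable_to_countable' fun k => ?_
  -- The second set accounts for `sInf ∅ = 0`: the value 0 is also taken where no index passes.
  have hset : kStar ⁻¹' {k} = ({x : Fin n → ℝ | p k x} ∩ ⋂ j : ℕ, ⋂ _ : j < k, {x | p j x}ᶜ)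
      ∪ {x | k = 0 ∧ ∀ j, ¬ p j x} := by
    ext x
    simp only [Set.mem_preimage, Set.mem_singleton_iff, Set.mem_union, Set.mem_inter_iff,
      Set.mem_iInter, Set.mem_compl_iff, Set.mem_ofPred_eq, hk]
    constructor
    · rintro rfl
      by_cases hne : {k | p k x}.Nonempty
      · exact Or.inl ⟨Nat.sInf_mem hne, fun j hj => Nat.notMem_of_lt_sInf hj⟩
      · rw [Set.not_nonempty_iff_eq_empty] at hne
        refine Or.inr ⟨by simp [hne], fun j hj => ?_⟩
        exact (hne ▸ (show j ∈ {k | p k x} from hj) : j ∈ (∅ : Set ℕ)).elim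
    · rintro (⟨h1, h2⟩ | ⟨rfl, h⟩)
      · refine le_antisymm (Nat.sInf_le h1) (not_lt.1 fun hlt => h2 _ hlt ?_)
        exact Nat.sInf_mem (s := {k | p k x}) ⟨k, h1⟩
      · exact Nat.sInf_eq_zero.2 (Or.inr (Set.eq_empty_iff_forall_notMem.2 h))
  rw [hset]
  refine ((hpm k).inter (.iInter fun j => .iInter fun _ => (hpm j).compl)).union ?_
  by_cases hk0 : k = 0
  · have : {x : Fin n → ℝ | k = 0 ∧ ∀ j, ¬ p j x} = ⋂ j, {x | p j x}ᶜ := by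
      ext x; simp [hk0]
    rw [this]
    exact .iInter fun j => (hpm j).compl
  · simp [hk0]

/-- The index is countable, so `stat` is jointly measurable in index and sample. -/
lemma measurable_stat_kStar (n : ℕ) :
    Measurable fun x : Fin n → ℝ => stat (kStar x) x := by
  have h : Measurable (Function.uncurry fun (k : ℕ) (x : Fin n → ℝ) => stat k x) :=
    measurable_from_prod_countable_right fun k => measurable_stat k n
  have h2 : Measurable fun x : Fin n → ℝ => (kStar x, x) :=
    (measurable_kStar n).prodMk measurable_id
  have h3 := h.comp h2
  exact h3

/-! ### Limit theorems for samples from the mixtures -/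

section Mixture

variable {Ω : Type*} [MeasurableSpace Ω] {P : Measure Ω} [IsProbabilityMeasure P]
  {X Y : Ω → ℝ} {A : ℕ → Set Ω} {lam : ℝ}
  {Ω' : ℕ → Type*} [∀ n, MeasurableSpace (Ω' n)]
  {Q : (n : ℕ) → Measure (Ω' n)}
  {S : (n : ℕ) → Fin n → Ω' n → ℝ}

/-- A central limit theorem for samples from mixtures whose contamination has weight
`lam / √n`. -/
theorem tendsto_charFun_mixture_sum
    (hX : AEMeasurable X P) (hY : AEMeasurable Y P)
    (hA_meas : ∀ᶠ n in atTop, MeasurableSet (A n))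
    (hA_prob : ∀ᶠ n : ℕ in atTop, P.real (A n) = 1 - lam / √(n : ℝ))
    (hXA : ∀ᶠ n in atTop, IndepFun X ((A n).indicator fun _ => (1 : ℝ)) P)
    (hYA : ∀ᶠ n in atTop, IndepFun Y ((A n).indicator fun _ => (1 : ℝ)) P)
    (hS_meas : ∀ n i, AEMeasurable (S n i) (Q n))
    (hS_indep : ∀ᶠ n in atTop, iIndepFun (S n) (Q n))
    (hS_law : ∀ᶠ n in atTop, ∀ i, IdentDistrib (S n i)
      (fun ω => (A n).indicator X ω + (A n)ᶜ.indicator Y ω) (Q n) P)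
    {h : ℝ → ℝ} (hh : Measurable h) (hhX : MemLp (fun ω => h (X ω)) 2 P)
    (hhY : Integrable (fun ω => h (Y ω)) P) (hhX0 : ∫ ω, h (X ω) ∂P = 0) (t : ℝ) :
    Tendsto (fun n : ℕ => charFun ((Q n).map fun ω => (√(n : ℝ))⁻¹ * ∑ i, h (S n i ω)) t) atTop
      (𝓝 (charFun (gaussianReal (lam * ∫ ω, h (Y ω) ∂P) (∫ ω, h (X ω) ^ 2 ∂P).toNNReal) t)) := by
  have mX : AEMeasurable (fun ω => h (X ω)) P := hh.comp_aemeasurable hX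
  have mY : AEMeasurable (fun ω => h (Y ω)) P := hh.comp_aemeasurable hY
  have pX : IsProbabilityMeasure (P.map fun ω => h (X ω)) := Measure.isProbabilityMeasure_map mX
  have pY : IsProbabilityMeasure (P.map fun ω => h (Y ω)) := Measure.isProbabilityMeasure_map mY
  have oX := charFun_sub_isLittleO_sq (ρ := P.map fun ω => h (X ω))
    ((memLp_map_measure_iff aestronglyMeasurable_id mX).2 hhX)
    (by rw [integral_map mX (by fun_prop)]; exact hhX0)
  have oY := charFun_sub_isLittleO (ρ := P.map fun ω => h (Y ω))
    ((integrable_map_measure aestronglyMeasurable_id mY).2 hhY)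
  rw [integral_map mX (by fun_prop)] at oX
  rw [integral_map mY (by fun_prop)] at oY
  have hlim := tendsto_mixture_pow oX oY lam t
  rw [charFun_gaussianReal, Real.coe_toNNReal _ (integral_nonneg fun ω => sq_nonneg _)]
  refine hlim.congr' ?_
  filter_upwards [hA_meas, hA_prob, hXA, hYA, hS_indep, hS_law] with n h1 h2 h3 h4 h5 h6
  have mS : ∀ i, AEMeasurable (fun ω => h (S n i ω)) (Q n) :=
    fun i => hh.comp_aemeasurable (hS_meas n i)
  rw [charFun_map_mul_comp (Finset.aemeasurable_fun_sum _ fun i _ => mS i),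
    (h5.comp (fun _ => h) fun _ => hh).charFun_map_fun_sum_eq_prod mS]
  have hone : ∀ s i, charFun ((Q n).map fun ω => h (S n i ω)) s
      = ((1 - lam / √(n : ℝ) : ℝ) : ℂ) * charFun (P.map fun ω => h (X ω)) s
        + ((lam / √(n : ℝ) : ℝ) : ℂ) * charFun (P.map fun ω => h (Y ω)) s := by
    intro s i
    have hg : Measurable fun z : ℝ => Complex.exp (s * h z * Complex.I) := by fun_prop
    have hint : ∀ {W : Ω → ℝ}, AEMeasurable W P →
        Integrable (fun ω => Complex.exp (s * h (W ω) * Complex.I)) P := fun {W} hW => by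
      refine Integrable.of_bound (hg.comp_aemeasurable hW).aestronglyMeasurable 1
        (.of_forall fun ω => ?_)
      rw [← Complex.ofReal_mul, Complex.norm_exp_ofReal_mul_I]
    rw [show (Q n).map (fun ω => h (S n i ω)) = _ from ((h6 i).comp hh).map_eq, charFun_apply_real, charFun_apply_real, charFun_apply_real,
      integral_map mX (by fun_prop), integral_map mY (by fun_prop),
      integral_map ((h6 i).comp hh).aemeasurable_snd (by fun_prop)]
    refine (integral_comp_mixture h1 hX hY h3 h4 hg.stronglyMeasurable (hint hX)
      (hint hY)).trans ?_
    rw [h2, sub_sub_cancel, Complex.real_smul, Complex.real_smul]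
  simp [Finset.prod_apply, hone]

/-- The sample mean of the mixtures is `√n`-consistent when both components have the same mean. -/
lemma eventually_measureReal_sampleMean_le [∀ n, IsProbabilityMeasure (Q n)] {θ : ℝ}
    (hX : MemLp X 2 P) (hY : MemLp Y 2 P) (hXθ : ∫ ω, X ω ∂P = θ) (hYθ : ∫ ω, Y ω ∂P = θ)
    (hA_meas : ∀ᶠ n in atTop, MeasurableSet (A n))
    (hXA : ∀ᶠ n in atTop, IndepFun X ((A n).indicator fun _ => (1 : ℝ)) P)
    (hYA : ∀ᶠ n in atTop, IndepFun Y ((A n).indicator fun _ => (1 : ℝ)) P)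
    (hS_indep : ∀ᶠ n in atTop, iIndepFun (S n) (Q n))
    (hS_law : ∀ᶠ n in atTop, ∀ i, IdentDistrib (S n i)
      (fun ω => (A n).indicator X ω + (A n)ᶜ.indicator Y ω) (Q n) P) :
    ∀ᶠ n : ℕ in atTop, ∀ c : ℝ, 0 < c →
      (Q n).real {ω | c ≤ |sampleMean (fun i => S n i ω) - θ|}
        ≤ (Var[X; P] + Var[Y; P]) / (n * c ^ 2) := by
  filter_upwards [eventually_gt_atTop 0, hA_meas, hXA, hYA, hS_indep, hS_law]
    with n hn h1 h3 h4 h5 h6 c hc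
  have hZ : MemLp (fun ω => (A n).indicator X ω + (A n)ᶜ.indicator Y ω) 2 P :=
    (hX.indicator h1).add (hY.indicator h1.compl)
  have hmean : ∫ ω, ((A n).indicator X ω + (A n)ᶜ.indicator Y ω) ∂P = θ := by
    refine (integral_comp_mixture (g := fun z => z) h1 hX.aemeasurable hY.aemeasurable h3 h4
      stronglyMeasurable_id (hX.integrable (by norm_num)) (hY.integrable (by norm_num))).trans ?_
    rw [hXθ, hYθ, smul_eq_mul, smul_eq_mul]
    ring
  -- Both components have mean `θ`, so the variance of the mixture is the convex combination of
  -- theirs, with no between-component term.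
  have hvar : Var[fun ω => (A n).indicator X ω + (A n)ᶜ.indicator Y ω; P]
      ≤ Var[X; P] + Var[Y; P] := by
    rw [variance_eq_integral hZ.aemeasurable, hmean]
    refine (integral_comp_mixture (g := fun z => (z - θ) ^ 2) h1 hX.aemeasurable hY.aemeasurable
      h3 h4 (Continuous.stronglyMeasurable (by fun_prop))
      (hX.sub (memLp_const θ)).integrable_sq (hY.sub (memLp_const θ)).integrable_sq).trans_le ?_
    have vX := variance_eq_integral hX.aemeasurable
    have vY := variance_eq_integral hY.aemeasurable
    rw [hXθ] at vX
    rw [hYθ] at vY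
    rw [← vX, ← vY, smul_eq_mul, smul_eq_mul]
    have := variance_nonneg X P
    have := variance_nonneg Y P
    have := measureReal_le_one (μ := P) (s := A n)
    have := measureReal_nonneg (μ := P) (s := A n)
    nlinarith
  exact measureReal_sampleMean_le hn (fun i => (h6 i).memLp_iff.2 hZ) h5
    (fun i => (h6 i).integral_eq.trans hmean) (fun i => (h6 i).variance_eq.trans_le hvar) hc

end Mixture

end PoissonTest

/-! ### The limit theorem -/

open PoissonTest in
theorem proposition3
    {Ω : Type*} [MeasurableSpace Ω] (P : Measure Ω) [IsProbabilityMeasure P]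
    (mu : ℝ≥0) (hmu : 0 < mu) (lam : ℝ) (hlam : 0 < lam)
    -- the Poisson variable, the contaminating variable and the mixing events
    (X : Ω → ℕ) (hX : HasLaw X (poissonMeasure mu) P)
    (Y : Ω → ℝ) (hY_nonneg : ∀ᵐ ω ∂P, 0 ≤ Y ω) (hY_sq : MemLp Y 2 P)
    (hY_mean : ∫ ω, Y ω ∂P = mu)
    (A : ℕ → Set Ω)
    (hA_meas : ∀ n : ℕ, lam ^ 2 ≤ n → MeasurableSet (A n))
    (hA_prob : ∀ n : ℕ, lam ^ 2 ≤ n → P.real (A n) = 1 - lam / √(n : ℝ))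
    (h_indep : ∀ n : ℕ, lam ^ 2 ≤ n →
      iIndepFun ![fun ω => (X ω : ℝ), Y, (A n).indicator fun _ => (1 : ℝ)] P)
    -- for each `n ≥ lam ^ 2`, a random sample of size `n` from the `n`-th mixture
    {Ω' : ℕ → Type*} [∀ n, MeasurableSpace (Ω' n)]
    (Q : (n : ℕ) → Measure (Ω' n)) [∀ n, IsProbabilityMeasure (Q n)]
    (S : (n : ℕ) → Fin n → Ω' n → ℝ)
    (hS_meas : ∀ n i, AEMeasurable (S n i) (Q n))
    (hS_indep : ∀ n : ℕ, lam ^ 2 ≤ n → iIndepFun (S n) (Q n))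
    (hS_law : ∀ n : ℕ, lam ^ 2 ≤ n → ∀ i,
      IdentDistrib (S n i)
        (fun ω => (A n).indicator (fun ω => (X ω : ℝ)) ω + (A n)ᶜ.indicator Y ω) (Q n) P) :
    -- the limit of the statistic with a fixed index, with both expressions of its variance
    (∀ k : ℕ,
      TendstoInDistribution (fun n ω => PoissonTest.stat k (fun i => S n i ω)) atTop id Q
        (gaussianReal (-lam * (P.real {ω | Y ω ≤ k} - PoissonTest.f k mu))
          (PoissonTest.sigmaSq k mu).toNNReal) ∧
      PoissonTest.sigmaSq k mu =
        Var[fun ω => Real.exp (-(mu : ℝ)) * (mu : ℝ) ^ k / (k ! : ℝ) * X ω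
          + (if X ω ≤ k then (1 : ℝ) else 0); P]) ∧
    -- the data-driven statistic is asymptotically equivalent to the one with index `0`
    (∀ ε : ℝ, 0 < ε →
      Tendsto (fun n => Q n {ω | ε ≤
        |PoissonTest.stat (PoissonTest.kStar fun i => S n i ω) (fun i => S n i ω)
          - PoissonTest.stat 0 (fun i => S n i ω)|}) atTop (𝓝 0)) ∧
    -- and both have the stated limit
    TendstoInDistribution (fun n ω => PoissonTest.stat 0 (fun i => S n i ω)) atTop id Q
      (gaussianReal (lam * (Real.exp (-(mu : ℝ)) - P.real {ω | Y ω = 0}))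
        (Real.exp (-2 * (mu : ℝ)) * (Real.exp (mu : ℝ) - 1 - mu)).toNNReal) ∧
    TendstoInDistribution
      (fun n ω => PoissonTest.stat (PoissonTest.kStar fun i => S n i ω) (fun i => S n i ω))
      atTop id Q
      (gaussianReal (lam * (Real.exp (-(mu : ℝ)) - P.real {ω | Y ω = 0}))
        (Real.exp (-2 * (mu : ℝ)) * (Real.exp (mu : ℝ) - 1 - mu)).toNNReal) := by
  have hev : ∀ᶠ n : ℕ in atTop, lam ^ 2 ≤ n :=
    tendsto_natCast_atTop_atTop.eventually_ge_atTop (lam ^ 2)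
  set Xr : Ω → ℝ := fun ω => (X ω : ℝ) with hXr
  have mX : AEMeasurable X P := hX.aemeasurable
  have mXr : AEMeasurable Xr P := (measurable_of_countable _).comp_aemeasurable mX
  have mY : AEMeasurable Y P := hY_sq.aemeasurable
  have int_X : ∀ g : ℕ → ℝ, ∫ ω, g (X ω) ∂P = ∫ j, g j ∂poissonMeasure mu := fun g =>
    hX.integral_comp .of_discrete
  have memLp_X : ∀ g : ℕ → ℝ, MemLp g 2 (poissonMeasure mu) → MemLp (fun ω => g (X ω)) 2 P := by
    intro g hg
    rw [← hX.map_eq] at hg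
    exact hg.comp_of_map mX
  have hXr_sq : MemLp Xr 2 P := memLp_X _ (memLp_natCast_poissonMeasure mu)
  have hXr_mean : ∫ ω, Xr ω ∂P = mu :=
    (int_X fun j => (j : ℝ)).trans (integral_natCast_poissonMeasure mu).2
  have hA_meas' : ∀ᶠ n in atTop, MeasurableSet (A n) := hev.mono hA_meas
  have hA_prob' : ∀ᶠ n : ℕ in atTop, P.real (A n) = 1 - lam / √(n : ℝ) := hev.mono hA_prob
  have hXA : ∀ᶠ n in atTop, IndepFun Xr ((A n).indicator fun _ => (1 : ℝ)) P :=
    hev.mono fun n hn => (h_indep n hn).indepFun (i := 0) (j := 2) (by decide)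
  have hYA : ∀ᶠ n in atTop, IndepFun Y ((A n).indicator fun _ => (1 : ℝ)) P :=
    hev.mono fun n hn => (h_indep n hn).indepFun (i := 1) (j := 2) (by decide)
  have hS_indep' : ∀ᶠ n in atTop, iIndepFun (S n) (Q n) := hev.mono hS_indep
  have hS_law' : ∀ᶠ n in atTop, ∀ i, IdentDistrib (S n i)
      (fun ω => (A n).indicator Xr ω + (A n)ᶜ.indicator Y ω) (Q n) P := hev.mono hS_law
  have mS : ∀ n, AEMeasurable (fun ω i => S n i ω) (Q n) :=
    fun n => aemeasurable_pi_lambda _ (hS_meas n)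
  have hmean := eventually_measureReal_sampleMean_le hXr_sq hY_sq hXr_mean hY_mean hA_meas' hXA
    hYA hS_indep' hS_law'
  have hVar : ∀ k : ℕ, sigmaSq k mu
      = Var[fun ω => Real.exp (-(mu : ℝ)) * (mu : ℝ) ^ k / (k ! : ℝ) * X ω
          + (if X ω ≤ k then (1 : ℝ) else 0); P] := by
    intro k
    rw [← variance_poissonMeasure, ← hX.map_eq, variance_map .of_discrete mX]
    rfl
  have hlin : ∀ k : ℕ, ∃ U : (n : ℕ) → Ω' n → ℝ, (∀ n, AEMeasurable (U n) (Q n)) ∧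
      (∀ t, Tendsto (fun n => charFun ((Q n).map (U n)) t) atTop
        (𝓝 (charFun (gaussianReal (-lam * (P.real {ω | Y ω ≤ k} - f k mu))
          (sigmaSq k mu).toNNReal) t))) ∧
      ∀ ε : ℝ, 0 < ε → Tendsto (fun n => (Q n).real
        {ω | ε ≤ |stat k (fun i => S n i ω) - U n ω|}) atTop (𝓝 0) := by
    intro k
    set c := Real.exp (-(mu : ℝ)) * (mu : ℝ) ^ k / (k ! : ℝ) with hc
    -- The influence function of the statistic at the Poisson law; the derivative of `f k` at `mu`
    -- is `-c`.
    set h : ℝ → ℝ := fun z => f k mu - (if z ≤ k then 1 else 0) - c * (z - mu) with hh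
    have hhm : Measurable h :=
      (measurable_const.sub (Measurable.ite measurableSet_Iic measurable_const
        measurable_const)).sub (by fun_prop)
    have mW : MemLp (fun j : ℕ => c * j + (if j ≤ k then (1 : ℝ) else 0)) 2 (poissonMeasure mu) :=
      ((memLp_natCast_poissonMeasure mu).const_mul c).add (memLp_ite_poissonMeasure mu k)
    have eW : ∫ ω, (c * X ω + (if X ω ≤ k then (1 : ℝ) else 0)) ∂P = c * mu + f k mu := by
      rw [int_X fun j => c * j + (if j ≤ k then (1 : ℝ) else 0),
        integral_add ((integral_natCast_poissonMeasure mu).1.const_mul c)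
          (integrable_ite_poissonMeasure mu (· ≤ k)), integral_const_mul,
        (integral_natCast_poissonMeasure mu).2, integral_ite_le_poissonMeasure]
    -- `h(X)` is the centred variable of `hVar` with its sign reversed, hence has mean zero and
    -- variance `sigmaSq k mu`.
    have hhX : ∀ ω, h (Xr ω)
        = c * mu + f k mu - (c * X ω + (if X ω ≤ k then (1 : ℝ) else 0)) := by
      intro ω
      simp only [hh, hXr, Nat.cast_le]
      ring
    have mhX : MemLp (fun ω => h (Xr ω)) 2 P := by
      simp only [hhX]
      exact (memLp_const _).sub (memLp_X _ mW)
    have ehX : ∫ ω, h (Xr ω) ∂P = 0 := by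
      simp only [hhX]
      rw [integral_sub (integrable_const _) ((memLp_X _ mW).integrable (by norm_num)), eW]
      simp
    have vhX : ∫ ω, h (Xr ω) ^ 2 ∂P = sigmaSq k mu := by
      rw [hVar k, variance_eq_integral (memLp_X _ mW).aemeasurable, eW]
      refine integral_congr_ae (.of_forall fun ω => ?_)
      simp only [hhX]
      ring
    have sY : NullMeasurableSet {ω | Y ω ≤ k} P := nullMeasurableSet_le mY aemeasurable_const
    have iY : Integrable Y P := hY_sq.integrable (by norm_num)
    have iteY : (fun ω => if Y ω ≤ k then (1 : ℝ) else 0)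
        = {ω | Y ω ≤ k}.indicator fun _ => (1 : ℝ) := by
      funext ω
      simp [Set.indicator_apply]
    have iI : Integrable (fun ω => if Y ω ≤ k then (1 : ℝ) else 0) P := by
      rw [iteY]
      exact (integrable_const _).indicator₀ sY
    have eI : ∫ ω, (if Y ω ≤ k then (1 : ℝ) else 0) ∂P = P.real {ω | Y ω ≤ k} := by
      rw [iteY, integral_indicator₀ sY]
      simp
    have iL : Integrable (fun ω => c * (Y ω - mu)) P := (iY.sub (integrable_const _)).const_mul c
    have ihY : Integrable (fun ω => h (Y ω)) P := ((integrable_const _).sub iI).sub iL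
    have ehY : ∫ ω, h (Y ω) ∂P = f k mu - P.real {ω | Y ω ≤ k} := by
      simp only [hh]
      rw [integral_sub (by exact (integrable_const _).sub iI) iL, integral_sub (integrable_const _) iI, eI,
        integral_const_mul, integral_sub iY (integrable_const _), hY_mean]
      simp
    refine ⟨fun n ω => (√(n : ℝ))⁻¹ * ∑ i, h (S n i ω), fun n => ?_, fun t => ?_, fun ε hε => ?_⟩
    · exact (Finset.aemeasurable_fun_sum _ fun i _ =>
        hhm.comp_aemeasurable (hS_meas n i)).const_mul _
    · have hlim := tendsto_charFun_mixture_sum mXr mY hA_meas' hA_prob' hXA hYA hS_meas hS_indep'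
        hS_law' hhm mhX ihY ehX t
      rw [vhX, ehY] at hlim
      rwa [show -lam * (P.real {ω | Y ω ≤ k} - f k mu)
        = lam * (f k mu - P.real {ω | Y ω ≤ k}) by ring]
    · refine (tendsto_measureReal_remainder hmean (hasDerivAt_f k mu) hε).congr' ?_
      filter_upwards [eventually_gt_atTop 0] with n hn
      have hn' : (0 : ℝ) < n := by exact_mod_cast hn
      congr 1
      ext ω
      have hs : (√(n : ℝ))⁻¹ = √(n : ℝ) / n := by
        rw [inv_eq_one_div, div_eq_div_iff (Real.sqrt_pos.2 hn').ne' hn'.ne',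
          Real.mul_self_sqrt hn'.le, one_mul]
      -- The scaled delta-method remainder is exactly the statistic minus its linear part.
      have hid : √(n : ℝ) * (f k (sampleMean fun i => S n i ω) - f k mu
            - -(Real.exp (-(mu : ℝ)) * (mu : ℝ) ^ k / (k ! : ℝ))
              * ((sampleMean fun i => S n i ω) - mu))
          = stat k (fun i => S n i ω) - (√(n : ℝ))⁻¹ * ∑ i, h (S n i ω) := by
        rw [← hc, hs, stat, empCdf]
        simp only [hh, Finset.sum_sub_distrib, ← Finset.mul_sum, Finset.sum_const,
          Finset.card_univ, Fintype.card_fin, nsmul_eq_mul]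
        rw [sampleMean]
        field_simp
        ring
      simp only [Set.mem_ofPred_eq, hid]
  have hkStar : ∀ᶠ n : ℕ in atTop, ∀ ω, sampleMean (fun i => S n i ω) ≤ mu + 1 →
      kStar (fun i => S n i ω) = 0 := by
    have hlim : Tendsto (fun n : ℕ => Real.exp (2 * (mu + 1)) / √(n : ℝ)) atTop (𝓝 0) :=
      tendsto_const_nhds.div_atTop (Real.tendsto_sqrt_atTop.comp tendsto_natCast_atTop_atTop)
    filter_upwards [hlim.eventually_le_const (Real.exp_pos 1)] with n hn ω hω
    exact kStar_eq_zero hω hn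
  have hequiv : ∀ ε : ℝ, 0 < ε → Tendsto (fun n => (Q n).real {ω | ε ≤
      |stat (kStar fun i => S n i ω) (fun i => S n i ω) - stat 0 (fun i => S n i ω)|})
      atTop (𝓝 0) := by
    intro ε hε
    have hlim : Tendsto (fun n : ℕ => (Var[Xr; P] + Var[Y; P]) / (n * (1 : ℝ) ^ 2)) atTop (𝓝 0) :=
      tendsto_const_nhds.div_atTop (tendsto_natCast_atTop_atTop.atTop_mul_const (by positivity))
    refine tendsto_of_tendsto_of_tendsto_of_le_of_le' tendsto_const_nhds hlim
      (.of_forall fun n => measureReal_nonneg) ?_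
    filter_upwards [hmean, hkStar] with n h1 h2
    -- Where the two statistics differ, the index is nonzero, so the sample mean exceeds `mu + 1`: a
    -- deviation of at least 1.
    refine (measureReal_mono (fun ω hω => ?_) (measure_ne_top _ _)).trans (h1 1 one_pos)
    by_contra hcon
    simp only [Set.mem_ofPred_eq, not_le] at hcon hω
    rw [h2 ω (by linarith [(abs_lt.1 hcon).2])] at hω
    simp at hω
    linarith
  have hstat : ∀ k : ℕ, TendstoInDistribution (fun n ω => stat k (fun i => S n i ω)) atTop id Q
      (gaussianReal (-lam * (P.real {ω | Y ω ≤ k} - f k mu)) (sigmaSq k mu).toNNReal) := by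
    intro k
    obtain ⟨U, hU, hUc, hUs⟩ := hlin k
    exact tendstoInDistribution_of_charFun hU
      (fun n => (measurable_stat k n).comp_aemeasurable (mS n)) hUc hUs
  have hτ : lam * (Real.exp (-(mu : ℝ)) - P.real {ω | Y ω = 0})
      = -lam * (P.real {ω | Y ω ≤ (0 : ℕ)} - f 0 mu) := by
    -- Nonnegativity of `Y` makes the two events equal almost surely.
    have : P.real {ω | Y ω = 0} = P.real {ω | Y ω ≤ (0 : ℕ)} := by
      refine measureReal_congr ?_
      filter_upwards [hY_nonneg] with ω hω
      refine propext ⟨fun h => ?_, fun h => ?_⟩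
      · exact_mod_cast (show Y ω = 0 from h).le
      · exact le_antisymm (by exact_mod_cast (show Y ω ≤ (0 : ℕ) from h)) hω
    rw [this, f_zero]
    ring
  refine ⟨fun k => ⟨hstat k, hVar k⟩, fun ε hε => ?_, ?_, ?_⟩
  · have h := ENNReal.tendsto_ofReal (hequiv ε hε)
    rw [ENNReal.ofReal_zero] at h
    exact h.congr fun n => ofReal_measureReal (measure_ne_top _ _)
  · rw [hτ, ← sigmaSq_zero]
    exact hstat 0
  · rw [hτ, ← sigmaSq_zero]
    -- Slutsky's lemma is applied with `stat 0` itself as the approximating sequence.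
    have hc := fun t => ProbabilityMeasure.tendsto_iff_tendsto_charFun.1 (hstat 0).tendsto t
    simp only [ProbabilityMeasure.coe_mk, Measure.map_id] at hc
    exact tendstoInDistribution_of_charFun (hstat 0).forall_aemeasurable
      (fun n => (measurable_stat_kStar n).comp_aemeasurable (mS n)) hc hequiv
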